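/- For a positive integer $n$ let $\sigma(n)=\sum_{d\mid n} d$ denote the sum of its positive divisors. There is an absolute constant $C>0$ such that for every integer $a$ and every real number $x\ge 2$, $$\#\{n\in\mathbb{Z} : 1\le n\le x,\ \sigma(n)\equiv a \pmod n\}\le C\,\frac{x}{\log x}.$$ -/

import Mathlib

open Finset

/-! Write `n = p q c` with `p ≥ q` the two greatest prime factors, counted with multiplicity. If `p
∤ qc` and `p ∤ σ(qc)`, reducing the congruence mod `p` gives `σ(qc) ≡ a`. If `q ∤ c` this reads `(1
+ q) σ(c) ≡ a` and fixes `q` mod `p`, hence `q` itself since `q < p`; if `q ∣ c` then `q` is the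
greatest prime factor `P(c)`. So `n ↦ (p, c)` is at most two-to-one on such `n`, uniformly in `a`,
and it suffices to count pairs.

Take `Y` near `x^(1/3)` and `Z` near `(log x)^2`. For `c ≤ Y`, `p ≤ x / (c P(c))`, so Chebyshev and
the convergence of `∑ 1 / (c P(c))` give `O(x / log x)` pairs. If `q ≥ Z`, then `p` is a prime
factor of `pc ≤ x / Z`. If `c > Y` and `q < Z`, then `n` has a large smooth divisor, which is rare
by Rankin's method. The other exceptions (`n` prime, `p² ∣ n`, `p ∣ σ(n / p)`) are counted directly.
`card_solutions_le` assembles the cover and `exists_card_solutions_le` inserts the estimates. -/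

/-- The greatest prime factor of `n`, with value `1` if `n` has none. -/
def greatestPrimeFactor (n : ℕ) : ℕ := max 1 (n.primeFactors.sup id)

theorem one_le_greatestPrimeFactor (n : ℕ) : 1 ≤ greatestPrimeFactor n := le_max_left _ _

theorem le_greatestPrimeFactor {n p : ℕ} (hn : n ≠ 0) (hp : p.Prime) (h : p ∣ n) :
    p ≤ greatestPrimeFactor n :=
  le_max_of_le_right (Finset.le_sup (f := id) (Nat.mem_primeFactors.2 ⟨hp, h, hn⟩))

theorem greatestPrimeFactor_mem_primeFactors {n : ℕ} (hn : 2 ≤ n) :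
    greatestPrimeFactor n ∈ n.primeFactors := by
  have hne : n.primeFactors.Nonempty := Nat.nonempty_primeFactors.2 (by omega)
  obtain ⟨p, hp, hpe⟩ := Finset.exists_mem_eq_sup _ hne (id : ℕ → ℕ)
  have h1 : 1 ≤ p := (Nat.prime_of_mem_primeFactors hp).one_lt.le
  rw [greatestPrimeFactor, hpe]
  simpa [max_eq_right h1] using hp

theorem prime_greatestPrimeFactor {n : ℕ} (hn : 2 ≤ n) : (greatestPrimeFactor n).Prime :=
  Nat.prime_of_mem_primeFactors (greatestPrimeFactor_mem_primeFactors hn)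

theorem greatestPrimeFactor_dvd (n : ℕ) : greatestPrimeFactor n ∣ n := by
  rcases lt_or_ge n 2 with h | h
  · interval_cases n <;> simp [greatestPrimeFactor]
  · exact Nat.dvd_of_mem_primeFactors (greatestPrimeFactor_mem_primeFactors h)

theorem greatestPrimeFactor_le_of_dvd {m n : ℕ} (hn : n ≠ 0) (h : m ∣ n) :
    greatestPrimeFactor m ≤ greatestPrimeFactor n := by
  rcases lt_or_ge m 2 with h2 | h2
  · have : greatestPrimeFactor m = 1 := by interval_cases m <;> simp [greatestPrimeFactor]
    exact this ▸ one_le_greatestPrimeFactor n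
  · exact le_greatestPrimeFactor hn (prime_greatestPrimeFactor h2)
      ((greatestPrimeFactor_dvd m).trans h)

theorem mem_smoothNumbers_of_greatestPrimeFactor_lt {n k : ℕ} (hn : n ≠ 0)
    (h : greatestPrimeFactor n < k) : n ∈ Nat.smoothNumbers k :=
  Nat.mem_smoothNumbers'.2 fun _ hp hpn ↦ (le_greatestPrimeFactor hn hp hpn).trans_lt h

/-! ### Reduction of the congruence modulo a prime factor -/

theorem sigma_prime_mul {p m : ℕ} (hp : p.Prime) (hpm : ¬ p ∣ m) :
    ArithmeticFunction.sigma 1 (p * m) = (1 + p) * ArithmeticFunction.sigma 1 m := by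
  have hc : p.Coprime m := (Nat.Prime.coprime_iff_not_dvd hp).2 hpm
  rw [ArithmeticFunction.isMultiplicative_sigma.map_mul_of_coprime hc]
  congr 1
  have := ArithmeticFunction.sigma_one_apply_prime_pow (p := p) (i := 1) hp
  simpa [Finset.sum_range_succ] using this

/-- For `p` prime with `p ∤ m`, the congruence `σ(pm) ≡ a (mod pm)` forces `σ(m) ≡ a (mod p)`. -/
theorem sigma_modEq_of_sigma_prime_mul {p m : ℕ} {a : ℤ} (hp : p.Prime) (hpm : ¬ p ∣ m)
    (h : ((ArithmeticFunction.sigma 1 (p * m) : ℕ) : ℤ) ≡ a [ZMOD ((p * m : ℕ) : ℤ)]) :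
    ((ArithmeticFunction.sigma 1 m : ℕ) : ℤ) ≡ a [ZMOD (p : ℤ)] := by
  have h2 : ((ArithmeticFunction.sigma 1 (p * m) : ℕ) : ℤ) ≡ a [ZMOD (p : ℤ)] :=
    h.of_dvd (by exact_mod_cast dvd_mul_right p m)
  refine Int.ModEq.trans ?_ h2
  rw [sigma_prime_mul hp hpm]
  refine (Int.modEq_iff_dvd.2 ⟨(ArithmeticFunction.sigma 1 m : ℕ), ?_⟩)
  push_cast
  ring

/-! ### The two-to-one map from `n` to `(p, c)` -/

/-- The integer `n` divided by its two greatest prime factors. -/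
def cofactor (n : ℕ) : ℕ :=
  n / greatestPrimeFactor n / greatestPrimeFactor (n / greatestPrimeFactor n)

theorem greatestPrimeFactor_mul_div (n : ℕ) :
    greatestPrimeFactor n * (n / greatestPrimeFactor n) = n :=
  Nat.mul_div_cancel' (greatestPrimeFactor_dvd n)

theorem greatestPrimeFactor_mul_cofactor (n : ℕ) :
    greatestPrimeFactor (n / greatestPrimeFactor n) * cofactor n = n / greatestPrimeFactor n :=
  greatestPrimeFactor_mul_div _

/-- The solutions `n ≤ N` of `σ(n) ≡ a (mod n)`. -/
noncomputable def solutions (a : ℤ) (N : ℕ) : Finset ℕ := by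
  classical
  exact (Icc 1 N).filter fun n ↦ ((ArithmeticFunction.sigma 1 n : ℕ) : ℤ) ≡ a [ZMOD (n : ℤ)]

theorem mem_solutions {a : ℤ} {N n : ℕ} : n ∈ solutions a N ↔ (1 ≤ n ∧ n ≤ N) ∧
    ((ArithmeticFunction.sigma 1 n : ℕ) : ℤ) ≡ a [ZMOD (n : ℤ)] := by
  simp [solutions]

/-- The composite solutions `n = p m` with `p ∤ m`, `p ∤ σ(m)`, where `p` is the greatest prime
factor of `n`. -/
noncomputable def genericSolutions (a : ℤ) (N : ℕ) : Finset ℕ := by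
  classical
  exact (solutions a N).filter fun n ↦ 2 ≤ n / greatestPrimeFactor n ∧
    ¬ greatestPrimeFactor n ∣ n / greatestPrimeFactor n ∧
    ¬ greatestPrimeFactor n ∣ ArithmeticFunction.sigma 1 (n / greatestPrimeFactor n)

theorem mem_genericSolutions {a : ℤ} {N n : ℕ} : n ∈ genericSolutions a N ↔
    n ∈ solutions a N ∧ 2 ≤ n / greatestPrimeFactor n ∧
    ¬ greatestPrimeFactor n ∣ n / greatestPrimeFactor n ∧
    ¬ greatestPrimeFactor n ∣ ArithmeticFunction.sigma 1 (n / greatestPrimeFactor n) := by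
  simp [genericSolutions]

theorem two_le_of_two_le_div {n : ℕ} (h : 2 ≤ n / greatestPrimeFactor n) : 2 ≤ n :=
  h.trans (Nat.div_le_self _ _)

theorem injOn_genericSolutions_of_not_dvd (a : ℤ) (N : ℕ) :
    Set.InjOn (fun n ↦ (greatestPrimeFactor n, cofactor n))
      {n | n ∈ genericSolutions a N ∧
        ¬ greatestPrimeFactor (n / greatestPrimeFactor n) ∣ cofactor n} := by
  rintro n ⟨hn, hqn⟩ k ⟨hk, hqk⟩ h
  obtain ⟨hp, hm⟩ := Prod.ext_iff.1 h
  simp only at hp hm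
  rw [mem_genericSolutions, mem_solutions] at hn hk
  obtain ⟨⟨-, hna⟩, hn2, hnd, hns⟩ := hn
  obtain ⟨⟨-, hka⟩, hk2, hkd, -⟩ := hk
  have hpp := prime_greatestPrimeFactor (two_le_of_two_le_div hn2)
  have hn0 : n ≠ 0 := by have := two_le_of_two_le_div hn2; omega
  have hk0 : k ≠ 0 := by have := two_le_of_two_le_div hk2; omega
  have hnq := greatestPrimeFactor_mul_cofactor n
  have hkq := greatestPrimeFactor_mul_cofactor k
  have hqnp := prime_greatestPrimeFactor hn2
  have hqkp := prime_greatestPrimeFactor hk2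
  have hn1 := greatestPrimeFactor_mul_div n
  have hk1 := greatestPrimeFactor_mul_div k
  have hqn_le := greatestPrimeFactor_le_of_dvd hn0 (Nat.div_dvd_of_dvd (greatestPrimeFactor_dvd n))
  have hqk_le := greatestPrimeFactor_le_of_dvd hk0 (Nat.div_dvd_of_dvd (greatestPrimeFactor_dvd k))
  have hqn_ne : greatestPrimeFactor (n / greatestPrimeFactor n) ≠ greatestPrimeFactor n :=
    fun h ↦ hnd (h.symm.dvd.trans (greatestPrimeFactor_dvd _))
  have hqk_ne : greatestPrimeFactor (k / greatestPrimeFactor k) ≠ greatestPrimeFactor k :=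
    fun h ↦ hkd (h.symm.dvd.trans (greatestPrimeFactor_dvd _))
  have hna' := sigma_modEq_of_sigma_prime_mul hpp hnd (a := a) (by rw [hn1]; exact hna)
  have hka' : ((ArithmeticFunction.sigma 1 (k / greatestPrimeFactor k) : ℕ) : ℤ) ≡ a
      [ZMOD (greatestPrimeFactor n : ℤ)] := by
    rw [hp]
    exact sigma_modEq_of_sigma_prime_mul (hp ▸ hpp) hkd (by rw [hk1]; exact hka)
  rw [← hnq, sigma_prime_mul hqnp hqn] at hna' hns
  rw [← hkq, sigma_prime_mul hqkp hqk] at hka'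
  rw [← hm] at hka' hkq
  have hns' : ¬ greatestPrimeFactor n ∣ ArithmeticFunction.sigma 1 (cofactor n) :=
    fun h ↦ hns (h.mul_left _)
  -- Cancelling `σ(c)`, a unit mod `p`, gives congruent values of `q`; both lie below `p`, so they
  -- are equal.
  have hq : greatestPrimeFactor (n / greatestPrimeFactor n) =
      greatestPrimeFactor (k / greatestPrimeFactor k) := by
    have h1 := Int.natCast_modEq_iff.1 (hna'.trans hka'.symm)
    have h2 := Nat.ModEq.cancel_right_of_coprime
      ((Nat.Prime.coprime_iff_not_dvd hpp).2 hns') h1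
    exact (Nat.ModEq.add_left_cancel' 1 h2).eq_of_lt_of_lt (by omega) (by omega)
  calc n = greatestPrimeFactor n * (greatestPrimeFactor (n / greatestPrimeFactor n) *
        cofactor n) := by rw [hnq, hn1]
    _ = greatestPrimeFactor k * (greatestPrimeFactor (k / greatestPrimeFactor k) *
        cofactor n) := by rw [hq, hp]
    _ = k := by rw [hkq, hk1]

/-- Here `q` is recovered from `c` alone, as its greatest prime factor; the congruence is not
needed. -/
theorem injOn_genericSolutions_of_dvd (a : ℤ) (N : ℕ) :
    Set.InjOn (fun n ↦ (greatestPrimeFactor n, cofactor n))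
      {n | n ∈ genericSolutions a N ∧
        greatestPrimeFactor (n / greatestPrimeFactor n) ∣ cofactor n} := by
  have key : ∀ n ∈ genericSolutions a N,
      greatestPrimeFactor (n / greatestPrimeFactor n) ∣ cofactor n →
      greatestPrimeFactor n * (greatestPrimeFactor (cofactor n) * cofactor n) = n := by
    intro n hn hd
    rw [mem_genericSolutions] at hn
    have hm0 : n / greatestPrimeFactor n ≠ 0 := by omega
    have hnq := greatestPrimeFactor_mul_cofactor n
    have hc0 : cofactor n ≠ 0 := fun h ↦ hm0 (by rw [← hnq, h, mul_zero])
    have : greatestPrimeFactor (cofactor n) = greatestPrimeFactor (n / greatestPrimeFactor n) :=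
      le_antisymm (greatestPrimeFactor_le_of_dvd hm0 (hnq ▸ dvd_mul_left _ _))
        (le_greatestPrimeFactor hc0 (prime_greatestPrimeFactor hn.2.1) hd)
    rw [this, hnq, greatestPrimeFactor_mul_div]
  rintro n ⟨hn, hqn⟩ k ⟨hk, hqk⟩ h
  obtain ⟨hp, hm⟩ := Prod.ext_iff.1 h
  simp only at hp hm
  rw [← key n hn hqn, ← key k hk hqk, hp, hm]

theorem card_genericSolutions_filter_le (a : ℤ) (N : ℕ) (P : ℕ → Prop) [DecidablePred P]
    (s : Finset (ℕ × ℕ))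
    (hs : ∀ n ∈ genericSolutions a N, P n → (greatestPrimeFactor n, cofactor n) ∈ s) :
    ((genericSolutions a N).filter P).card ≤ 2 * #s := by
  classical
  rw [← card_filter_add_card_filter_not (s := (genericSolutions a N).filter P)
    (fun n ↦ greatestPrimeFactor (n / greatestPrimeFactor n) ∣ cofactor n), two_mul]
  refine add_le_add ?_ ?_
  · refine card_le_card_of_injOn (fun n ↦ (greatestPrimeFactor n, cofactor n)) ?_
      ((injOn_genericSolutions_of_dvd a N).mono ?_)
    · intro n hn
      simp only [coe_filter, mem_filter, Set.mem_ofPred_eq] at hn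
      exact hs n hn.1.1 hn.1.2
    · intro n hn
      simp only [coe_filter, mem_filter, Set.mem_ofPred_eq] at hn
      exact ⟨hn.1.1, hn.2⟩
  · refine card_le_card_of_injOn (fun n ↦ (greatestPrimeFactor n, cofactor n)) ?_
      ((injOn_genericSolutions_of_not_dvd a N).mono ?_)
    · intro n hn
      simp only [coe_filter, mem_filter, Set.mem_ofPred_eq] at hn
      exact hs n hn.1.1 hn.1.2
    · intro n hn
      simp only [coe_filter, mem_filter, Set.mem_ofPred_eq] at hn
      exact ⟨hn.1.1, hn.2⟩

/-! ### Covering the solutions by explicit families -/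

/-- The integers `n ≤ N` with a divisor `d > Y` all of whose prime factors are `< Z`. -/
noncomputable def withSmoothDivisor (N Z Y : ℕ) : Finset ℕ := by
  classical
  exact (Icc 1 N).filter fun n ↦ ∃ d ∈ Nat.smoothNumbers Z, Y < d ∧ d ∣ n

/-- The integers `n ≤ N` divisible by `d ^ 2` for some `d ≥ Z`. -/
noncomputable def withSquareDivisor (N Z : ℕ) : Finset ℕ := by
  classical
  exact (Icc 1 N).filter fun n ↦ ∃ d, Z ≤ d ∧ d ^ 2 ∣ n

/-- For small `c`, `q ≥ P(c)` gives `p c P(c) ≤ n ≤ N`. For `q ≥ Z`, the pair is encoded by `j = pc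
= n / q ≤ N / Z` and a prime factor `p` of `j`. -/
theorem card_genericSolutions_filter_le_sum (a : ℤ) (N Z Y : ℕ) (hZ : 1 ≤ Z) :
    ((genericSolutions a N).filter fun n ↦ cofactor n ≤ Y ∨
        Z ≤ greatestPrimeFactor (n / greatestPrimeFactor n)).card ≤
      2 * (∑ m ∈ Icc 1 Y, Nat.primeCounting (N / (m * greatestPrimeFactor m)) +
        ∑ j ∈ Icc 1 (N / Z), #j.primeFactors) := by
  classical
  set s₁ : Finset (ℕ × ℕ) := ((Icc 1 Y).sigma fun m ↦
    Nat.primesLE (N / (m * greatestPrimeFactor m))).image fun t ↦ (t.2, t.1) with hs₁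
  set s₂ : Finset (ℕ × ℕ) := ((Icc 1 (N / Z)).sigma fun j ↦
    j.primeFactors).image fun t ↦ (t.2, t.1 / t.2) with hs₂
  have h₁ : #s₁ ≤ ∑ m ∈ Icc 1 Y, Nat.primeCounting (N / (m * greatestPrimeFactor m)) := by
    refine card_image_le.trans ?_
    rw [card_sigma]
    simp
  have h₂ : #s₂ ≤ ∑ j ∈ Icc 1 (N / Z), #j.primeFactors := by
    refine card_image_le.trans ?_
    rw [card_sigma]
  refine (card_genericSolutions_filter_le a N _ (s₁ ∪ s₂) ?_).trans
    (Nat.mul_le_mul_left 2 ((card_union_le _ _).trans (add_le_add h₁ h₂)))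
  intro n hn hcase
  rw [mem_genericSolutions, mem_solutions] at hn
  obtain ⟨⟨⟨-, hnN⟩, -⟩, hn2, -, -⟩ := hn
  have hpp := prime_greatestPrimeFactor (two_le_of_two_le_div hn2)
  have hnq := greatestPrimeFactor_mul_cofactor n
  have hn1 := greatestPrimeFactor_mul_div n
  have hc0 : cofactor n ≠ 0 := fun h ↦ by rw [h, mul_zero] at hnq; omega
  have hq1 := one_le_greatestPrimeFactor (n / greatestPrimeFactor n)
  rw [mem_union]
  refine hcase.imp (fun h ↦ ?_) fun h ↦ ?_
  · refine mem_image.2 ⟨⟨cofactor n, greatestPrimeFactor n⟩, ?_, rfl⟩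
    rw [mem_sigma, mem_Icc, Nat.mem_primesLE]
    refine ⟨⟨Nat.one_le_iff_ne_zero.2 hc0, h⟩, ?_, hpp⟩
    have hle : greatestPrimeFactor (cofactor n) ≤
        greatestPrimeFactor (n / greatestPrimeFactor n) :=
      greatestPrimeFactor_le_of_dvd (by omega) (hnq ▸ dvd_mul_left _ _)
    rw [Nat.le_div_iff_mul_le (Nat.mul_pos (Nat.pos_of_ne_zero hc0)
      (one_le_greatestPrimeFactor _))]
    calc greatestPrimeFactor n * (cofactor n * greatestPrimeFactor (cofactor n))
        ≤ greatestPrimeFactor n *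
          (cofactor n * greatestPrimeFactor (n / greatestPrimeFactor n)) := by gcongr
      _ = n := by rw [mul_comm (cofactor n), hnq, hn1]
      _ ≤ N := hnN
  · refine mem_image.2 ⟨⟨greatestPrimeFactor n * cofactor n, greatestPrimeFactor n⟩, ?_, ?_⟩
    · have hpos : 0 < greatestPrimeFactor n * cofactor n :=
        Nat.mul_pos hpp.pos (Nat.pos_of_ne_zero hc0)
      rw [mem_sigma, mem_Icc, Nat.mem_primeFactors]
      refine ⟨⟨hpos, ?_⟩, hpp, dvd_mul_right _ _, hpos.ne'⟩
      rw [Nat.le_div_iff_mul_le hZ]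
      calc greatestPrimeFactor n * cofactor n * Z
          ≤ greatestPrimeFactor n * cofactor n *
            greatestPrimeFactor (n / greatestPrimeFactor n) := by gcongr
        _ = n := by rw [mul_assoc, mul_comm (cofactor n), hnq, hn1]
        _ ≤ N := hnN
    · simp [Nat.mul_div_cancel_left _ hpp.pos]

/-- The solutions of `σ(n) ≡ a (mod n)` are covered by a few explicit families. -/
theorem card_solutions_le (a : ℤ) (N Z Y : ℕ) (hZ : 1 ≤ Z) :
    #(solutions a N) ≤ Y + #(withSmoothDivisor N Z Y) + #(withSquareDivisor N Z) +
      Nat.primeCounting N +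
      ∑ m ∈ Icc 1 (N / Z), #(ArithmeticFunction.sigma 1 m).primeFactors +
      2 * (∑ m ∈ Icc 1 Y, Nat.primeCounting (N / (m * greatestPrimeFactor m)) +
        ∑ j ∈ Icc 1 (N / Z), #j.primeFactors) := by
  classical
  set A : Finset ℕ := ((Icc 1 (N / Z)).sigma fun m ↦
    (ArithmeticFunction.sigma 1 m).primeFactors).image fun t ↦ t.2 * t.1 with hA
  have hAc : #A ≤ ∑ m ∈ Icc 1 (N / Z), #(ArithmeticFunction.sigma 1 m).primeFactors := by
    refine card_image_le.trans ?_
    rw [card_sigma]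
  set G := (genericSolutions a N).filter fun n ↦ cofactor n ≤ Y ∨
    Z ≤ greatestPrimeFactor (n / greatestPrimeFactor n) with hG
  have hGc := card_genericSolutions_filter_le_sum a N Z Y hZ
  rw [← hG] at hGc
  have hsub : solutions a N ⊆ Icc 1 Y ∪ withSmoothDivisor N Z Y ∪ withSquareDivisor N Z ∪
      Nat.primesLE N ∪ A ∪ G := by
    intro n hn
    have hn' := mem_solutions.1 hn
    obtain ⟨⟨hn1, hnN⟩, -⟩ := hn'
    simp only [mem_union]
    by_contra! hcon
    obtain ⟨⟨⟨⟨⟨hY, hS⟩, hD⟩, hP⟩, hAn⟩, hGn⟩ := hcon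
    have hYn : Y < n := by
      by_contra! h
      exact hY (mem_Icc.2 ⟨hn1, h⟩)
    have hS' : ∀ d ∈ Nat.smoothNumbers Z, d ∣ n → d ≤ Y := by
      intro d hd hdn
      by_contra! h
      exact hS (by simp [withSmoothDivisor, hn1, hnN]; exact ⟨d, hd, h, hdn⟩)
    -- Otherwise `n` is itself a smooth divisor exceeding `Y`.
    have hZp : Z ≤ greatestPrimeFactor n := by
      by_contra! h
      exact absurd (hS' n (mem_smoothNumbers_of_greatestPrimeFactor_lt (by omega) h) dvd_rfl)
        (by omega)
    have hD' : ∀ d, Z ≤ d → ¬ d ^ 2 ∣ n := by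
      intro d hd hdn
      exact hD (by simp [withSquareDivisor, hn1, hnN]; exact ⟨d, hd, hdn⟩)
    -- For `n = 1` the default value `1` of the greatest prime factor forces `Z ≤ 1`, and `1 ^ 2 ∣
    -- 1` puts `n` in the square-divisor family.
    have hn2 : 2 ≤ n := by
      by_contra! h
      have : n = 1 := by omega
      subst this
      exact hD' 1 (by simpa [greatestPrimeFactor] using hZp) (by norm_num)
    have hpp := prime_greatestPrimeFactor hn2
    have hmul := greatestPrimeFactor_mul_div n
    have hm2 : 2 ≤ n / greatestPrimeFactor n := by
      by_contra! h
      interval_cases hm : n / greatestPrimeFactor n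
      · omega
      · rw [mul_one] at hmul
        exact hP (Nat.mem_primesLE.2 ⟨hnN, hmul ▸ hpp⟩)
    have hnd : ¬ greatestPrimeFactor n ∣ n / greatestPrimeFactor n := by
      intro h
      refine hD' _ hZp ?_
      conv_rhs => rw [← hmul]
      rw [sq]
      exact mul_dvd_mul_left _ h
    have hns : ¬ greatestPrimeFactor n ∣
        ArithmeticFunction.sigma 1 (n / greatestPrimeFactor n) := by
      intro h
      refine hAn (mem_image.2 ⟨⟨n / greatestPrimeFactor n, greatestPrimeFactor n⟩, ?_, hmul⟩)
      rw [mem_sigma, mem_Icc, Nat.mem_primeFactors]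
      refine ⟨⟨one_le_two.trans hm2, ?_⟩, hpp, h,
        (ArithmeticFunction.sigma_pos _ _ (zero_lt_two.trans_le hm2).ne').ne'⟩
      exact (Nat.div_le_div_right hnN).trans (Nat.div_le_div_left hZp hZ)
    refine hGn (mem_filter.2 ⟨mem_genericSolutions.2 ⟨hn, hm2, hnd, hns⟩, ?_⟩)
    -- What remains is `c > Y` and `q < Z`: then `c` is a forbidden smooth divisor.
    by_contra! h
    have hnq := greatestPrimeFactor_mul_cofactor n
    have hc0 : cofactor n ≠ 0 := by omega
    have hcm : cofactor n ∣ n / greatestPrimeFactor n := hnq ▸ dvd_mul_left _ _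
    refine absurd (hS' (cofactor n) (mem_smoothNumbers_of_greatestPrimeFactor_lt hc0 ?_)
      (hcm.trans (Nat.div_dvd_of_dvd (greatestPrimeFactor_dvd n)))) (by omega)
    exact (greatestPrimeFactor_le_of_dvd (by omega) hcm).trans_lt h.2
  refine (card_le_card hsub).trans ?_
  have e1 := card_union_le (Icc 1 Y ∪ withSmoothDivisor N Z Y ∪ withSquareDivisor N Z ∪
      Nat.primesLE N ∪ A) G
  have e2 := card_union_le (Icc 1 Y ∪ withSmoothDivisor N Z Y ∪ withSquareDivisor N Z ∪
      Nat.primesLE N) A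
  have e3 := card_union_le (Icc 1 Y ∪ withSmoothDivisor N Z Y ∪ withSquareDivisor N Z)
      (Nat.primesLE N)
  have e4 := card_union_le (Icc 1 Y ∪ withSmoothDivisor N Z Y) (withSquareDivisor N Z)
  have e5 := card_union_le (Icc 1 Y) (withSmoothDivisor N Z Y)
  have e6 : #(Icc 1 Y) = Y := by simp
  have e7 : #(Nat.primesLE N) = Nat.primeCounting N := by simp
  omega

/-! ### Euler products and the convergence of `∑ 1 / (m P(m))` -/

theorem sum_le_prod_primesBelow {g : ℕ →* ℝ} (hg : ∀ n, 0 ≤ g n)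
    (hlt : ∀ p : ℕ, p.Prime → g p < 1) {N : ℕ} {s : Finset ℕ}
    (hs : ∀ m ∈ s, m ∈ Nat.smoothNumbers N) :
    ∑ m ∈ s, g m ≤ ∏ p ∈ N.primesBelow, (1 - g p)⁻¹ := by
  classical
  have h := EulerProduct.summable_and_hasSum_smoothNumbers_prod_primesBelow_geometric (f := g)
    (fun {p} hp ↦ by rw [Real.norm_of_nonneg (hg p)]; exact hlt p hp) N
  rw [← Finset.sum_subtype_of_mem (p := (· ∈ Nat.smoothNumbers N)) (fun m ↦ g m) hs]
  exact sum_le_hasSum _ (fun i _ ↦ hg _) h.2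

/-- The completely multiplicative function `n ↦ 1 / n`. -/
noncomputable def invHom : ℕ →* ℝ where
  toFun n := (n : ℝ)⁻¹
  map_one' := by simp
  map_mul' m n := by push_cast; rw [mul_inv]

/-- Each step of length two adds at most one odd prime `2k + 3`, and `(2k + 3)(2k + 1) ≤ (2k + 2)²`
makes the induction close. This weak form of Mertens' bound suffices. -/
theorem prod_primesBelow_inv_sq_le (k : ℕ) :
    (∏ p ∈ (2 * (k + 1)).primesBelow, (1 - (p : ℝ)⁻¹)⁻¹) ^ 2 ≤ 4 * (2 * k + 1) := by
  induction k with
  | zero => norm_num [Nat.primesBelow, Finset.range_add_one, Finset.filter_insert, Finset.filter_singleton]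
  | succ k ih =>
    have hstep : ∀ n : ℕ, (n + 1).primesBelow = if n.Prime then insert n n.primesBelow
        else n.primesBelow := by
      intro n
      simp [Nat.primesBelow, Finset.range_add_one, Finset.filter_insert]
    have e : 2 * (k + 1 + 1) = 2 * (k + 1) + 1 + 1 := by ring
    rw [e, hstep (2 * (k + 1) + 1), hstep (2 * (k + 1))]
    -- The first step is separate because the even number `2(k + 1)` is then the prime `2`.
    rcases Nat.eq_zero_or_pos k with rfl | hk
    · norm_num [Nat.primesBelow, Finset.range_add_one, Finset.filter_insert,
        Finset.filter_singleton]
    · have hnp : ¬ (2 * (k + 1)).Prime := Nat.not_prime_mul (by norm_num) (by omega)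
      rw [if_neg hnp]
      have hk' : (0 : ℝ) < k := by exact_mod_cast hk
      split_ifs with hp
      · rw [prod_insert (by simp [Nat.primesBelow]), mul_pow]
        have : (1 - ((2 * (k + 1) + 1 : ℕ) : ℝ)⁻¹)⁻¹ = (2 * k + 3) / (2 * k + 2) := by
          push_cast
          field_simp
          ring
        rw [this]
        refine (mul_le_mul_of_nonneg_left ih (sq_nonneg _)).trans ?_
        push_cast
        rw [div_pow, div_mul_eq_mul_div, div_le_iff₀ (by positivity)]
        nlinarith
      · push_cast
        linarith

theorem prod_primesBelow_inv_le (N : ℕ) :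
    ∏ p ∈ N.primesBelow, (1 - (p : ℝ)⁻¹)⁻¹ ≤ 4 * √(N + 1) := by
  have h1 : ∏ p ∈ N.primesBelow, (1 - (p : ℝ)⁻¹)⁻¹ ≤
      ∏ p ∈ (2 * (N / 2 + 1)).primesBelow, (1 - (p : ℝ)⁻¹)⁻¹ := by
    refine prod_le_prod_of_subset_of_one_le ?_ ?_ ?_
    · intro p hp
      rw [Nat.mem_primesBelow] at hp ⊢
      exact ⟨by omega, hp.2⟩
    · intro p hp
      have : (1 : ℝ) ≤ p := by exact_mod_cast (Nat.prime_of_mem_primesBelow hp).one_lt.le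
      exact inv_nonneg.2 (sub_nonneg.2 (inv_le_one_of_one_le₀ this))
    · intro p hp _
      have : (1 : ℝ) < p := by exact_mod_cast (Nat.prime_of_mem_primesBelow hp).one_lt
      refine (one_le_inv₀ (sub_pos.2 (inv_lt_one_of_one_lt₀ this))).2 ?_
      have : 0 < (p : ℝ)⁻¹ := by positivity
      linarith
  refine h1.trans ?_
  have h2 := prod_primesBelow_inv_sq_le (N / 2)
  refine (Real.le_sqrt_of_sq_le h2).trans ?_
  have h3 : (2 * (N / 2 : ℕ) : ℝ) ≤ N := by exact_mod_cast Nat.mul_div_le N 2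
  rw [show (4 : ℝ) = √16 by rw [show (16 : ℝ) = 4 ^ 2 by norm_num]; simp,
    ← Real.sqrt_mul (by norm_num)]
  refine Real.sqrt_le_sqrt ?_
  rw [show √(16 : ℝ) = 4 by rw [show (16 : ℝ) = 4 ^ 2 by norm_num]; simp]
  have : (0:ℝ) ≤ N := by positivity
  linarith

theorem sum_inv_smooth_le {N : ℕ} {s : Finset ℕ} (hs : ∀ m ∈ s, m ∈ Nat.smoothNumbers N) :
    ∑ m ∈ s, (m : ℝ)⁻¹ ≤ 4 * √(N + 1) := by
  refine (sum_le_prod_primesBelow (g := invHom) (fun n ↦ ?_) (fun p hp ↦ ?_) hs).trans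
    (prod_primesBelow_inv_le N)
  · simp [invHom]
  · exact inv_lt_one_of_one_lt₀ (by exact_mod_cast hp.one_lt)

/-- The series `∑ 1 / (m P(m))`, with `P(m)` the greatest prime factor of `m`, converges. -/
theorem exists_sum_inv_mul_greatestPrimeFactor_le :
    ∃ C : ℝ, 0 < C ∧ ∀ Y : ℕ, ∑ m ∈ Icc 1 Y, ((m * greatestPrimeFactor m : ℕ) : ℝ)⁻¹ ≤ C := by
  classical
  have hsum : Summable fun r : ℕ ↦ 8 * ((r : ℝ) ^ (3 / 2 : ℝ))⁻¹ :=
    (Real.summable_nat_rpow_inv.2 (by norm_num)).mul_left 8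
  have hnn : ∀ r : ℕ, 0 ≤ 8 * ((r : ℝ) ^ (3 / 2 : ℝ))⁻¹ := fun r ↦ by positivity
  refine ⟨1 + ∑' r : ℕ, 8 * ((r : ℝ) ^ (3 / 2 : ℝ))⁻¹,
    add_pos_of_pos_of_nonneg one_pos (tsum_nonneg hnn), fun Y ↦ ?_⟩
  have hsplit : ∑ m ∈ Icc 1 Y, ((m * greatestPrimeFactor m : ℕ) : ℝ)⁻¹ ≤
      1 + ∑ m ∈ Icc 2 Y, ((m * greatestPrimeFactor m : ℕ) : ℝ)⁻¹ := by
    have h1 : Icc 1 Y ⊆ insert 1 (Icc 2 Y) := by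
      intro m hm
      simp only [mem_insert, mem_Icc] at *
      omega
    refine (sum_le_sum_of_subset_of_nonneg h1 fun _ _ _ ↦ by positivity).trans ?_
    rw [sum_insert (by simp)]
    simp [greatestPrimeFactor]
  refine hsplit.trans (add_le_add_right ?_ 1)
  have hmaps : ∀ m ∈ Icc 2 Y, greatestPrimeFactor m ∈ Icc 1 Y := by
    intro m hm
    rw [mem_Icc] at hm
    exact mem_Icc.2 ⟨one_le_greatestPrimeFactor m,
      (Nat.le_of_dvd (by omega) (greatestPrimeFactor_dvd m)).trans hm.2⟩
  -- Group by `r = P(m)`: the quotients `m / r` are `(r + 1)`-smooth, so the group contributes `r⁻²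
  -- · O(√r)`, which is summable even over all integers `r`.
  rw [← sum_fiberwise_of_maps_to hmaps]
  refine (sum_le_sum fun r hr ↦ ?_).trans (hsum.sum_le_tsum _ fun r _ ↦ hnn r)
  have hr1 : (1 : ℝ) ≤ r := by exact_mod_cast (mem_Icc.1 hr).1
  have hr0 : (0 : ℝ) < r := by linarith
  set t := (Icc 2 Y).filter fun m ↦ greatestPrimeFactor m = r with ht
  have hmul : ∀ m ∈ t, r * (m / r) = m := by
    intro m hm
    rw [← (mem_filter.1 hm).2]
    exact greatestPrimeFactor_mul_div m
  have hinj : Set.InjOn (fun m ↦ m / r) (t : Set ℕ) := by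
    intro m hm n hn h
    simp only at h
    rw [← hmul m hm, ← hmul n hn, h]
  have hsm : ∀ m ∈ t.image fun m ↦ m / r, m ∈ Nat.smoothNumbers (r + 1) := by
    intro d hd
    obtain ⟨m, hm, rfl⟩ := mem_image.1 hd
    have hm' := mem_filter.1 hm
    have hm2 := (mem_Icc.1 hm'.1).1
    have hd0 : m / r ≠ 0 := fun h ↦ by have := hmul m hm; rw [h] at this; omega
    refine mem_smoothNumbers_of_greatestPrimeFactor_lt hd0 (Nat.lt_succ_of_le ?_)
    rw [← hm'.2]
    refine greatestPrimeFactor_le_of_dvd (by omega) ?_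
    exact Nat.div_dvd_of_dvd (greatestPrimeFactor_dvd m)
  have h1 := sum_inv_smooth_le hsm
  rw [sum_image hinj] at h1
  have h2 : ∑ m ∈ t, ((m * greatestPrimeFactor m : ℕ) : ℝ)⁻¹ =
      ((r : ℝ) ^ 2)⁻¹ * ∑ m ∈ t, ((m / r : ℕ) : ℝ)⁻¹ := by
    rw [mul_sum]
    refine sum_congr rfl fun m hm ↦ ?_
    rw [(mem_filter.1 hm).2]
    conv_lhs => rw [← hmul m hm]
    push_cast
    rw [← mul_inv]
    congr 1
    ring
  rw [h2]
  have h3 : √(((r + 1 : ℕ) : ℝ) + 1) ≤ 2 * √r := by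
    rw [show 2 * √(r : ℝ) = √(4 * r) by
      rw [Real.sqrt_mul (by norm_num), show (4 : ℝ) = 2 ^ 2 by norm_num]; simp]
    refine Real.sqrt_le_sqrt ?_
    push_cast
    linarith
  calc ((r : ℝ) ^ 2)⁻¹ * ∑ m ∈ t, ((m / r : ℕ) : ℝ)⁻¹
      ≤ ((r : ℝ) ^ 2)⁻¹ * (4 * (2 * √r)) := by
        gcongr
        exact h1.trans (by gcongr)
    _ = 8 * ((r : ℝ) ^ (3 / 2 : ℝ))⁻¹ := by
      rw [show (3 / 2 : ℝ) = 2 - 1 / 2 by norm_num, Real.rpow_sub hr0, ← Real.sqrt_eq_rpow]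
      norm_num
      field_simp
      norm_num

theorem card_primeFactors_le_log (n : ℕ) : #n.primeFactors ≤ Nat.log 2 n := by
  rcases Nat.eq_zero_or_pos n with rfl | hn
  · simp
  refine Nat.le_log_of_pow_le (by norm_num) ?_
  refine (Finset.pow_card_le_prod _ _ _ fun p hp ↦
    (Nat.prime_of_mem_primeFactors hp).two_le).trans ?_
  exact Nat.le_of_dvd hn (Nat.prod_primeFactors_dvd n)

/-! ### Rankin's method with exponent `3/4` -/

/-- The completely multiplicative function `n ↦ n ^ (-3/4)`. -/
noncomputable def invThreeQuarterHom : ℕ →* ℝ where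
  toFun n := (√√(n : ℝ))⁻¹ ^ 3
  map_one' := by simp
  map_mul' m n := by
    push_cast
    rw [Real.sqrt_mul (by positivity), Real.sqrt_mul (by positivity), mul_inv, mul_pow]

theorem sqrt_sqrt_pow_four {x : ℝ} (hx : 0 ≤ x) : (√√x) ^ 4 = x := by
  rw [show (√√x) ^ 4 = ((√√x) ^ 2) ^ 2 by ring, Real.sq_sqrt (Real.sqrt_nonneg x),
    Real.sq_sqrt hx]

/-- Telescoping: if `u⁴ - v⁴ = 1` with `0 ≤ v ≤ u`, factoring gives `1 ≤ 4u³(u - v)`. -/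
theorem sum_range_invThreeQuarterHom_le (Z : ℕ) :
    ∑ k ∈ range (Z + 1), invThreeQuarterHom k ≤ 4 * √√(Z : ℝ) := by
  induction Z with
  | zero => simp [invThreeQuarterHom]
  | succ Z ih =>
    rw [sum_range_succ]
    have hu : (√√((Z + 1 : ℕ) : ℝ)) ^ 4 = Z + 1 := by
      rw [sqrt_sqrt_pow_four (by positivity)]
      push_cast
      rfl
    have hv : (√√(Z : ℝ)) ^ 4 = Z := sqrt_sqrt_pow_four (by positivity)
    have huv : √√(Z : ℝ) ≤ √√((Z + 1 : ℕ) : ℝ) :=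
      Real.sqrt_le_sqrt (Real.sqrt_le_sqrt (by push_cast; linarith))
    have hu0 : 0 < √√((Z + 1 : ℕ) : ℝ) := by positivity
    have hv0 : 0 ≤ √√(Z : ℝ) := by positivity
    have hval : invThreeQuarterHom (Z + 1) = (√√((Z + 1 : ℕ) : ℝ))⁻¹ ^ 3 := rfl
    rw [hval]
    generalize √√((Z + 1 : ℕ) : ℝ) = u at *
    generalize √√(Z : ℝ) = v at *
    have h1 : u⁻¹ ^ 3 ≤ 4 * (u - v) := by
      rw [inv_pow, inv_le_iff_one_le_mul₀ (by positivity)]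
      have h2 : u ^ 4 - v ^ 4 = 1 := by linarith
      have h3 : u ^ 4 - v ^ 4 = (u - v) * (u ^ 3 + u ^ 2 * v + u * v ^ 2 + v ^ 3) := by ring
      have h4 : u ^ 2 * v ≤ u ^ 3 := by
        rw [pow_succ u 2]; gcongr
      have h5 : u * v ^ 2 ≤ u ^ 3 := by
        rw [pow_succ' u 2]; gcongr
      have h6 : v ^ 3 ≤ u ^ 3 := by gcongr
      calc (1 : ℝ) = (u - v) * (u ^ 3 + u ^ 2 * v + u * v ^ 2 + v ^ 3) := by rw [← h3, h2]
        _ ≤ (u - v) * (4 * u ^ 3) :=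
          mul_le_mul_of_nonneg_left (by linarith) (sub_nonneg.2 huv)
        _ = 4 * (u - v) * u ^ 3 := by ring
    linarith

theorem invThreeQuarterHom_nonneg (n : ℕ) : 0 ≤ invThreeQuarterHom n := by
  change 0 ≤ (√√(n : ℝ))⁻¹ ^ 3
  positivity

theorem invThreeQuarterHom_le_of_two_le {n : ℕ} (hn : 2 ≤ n) :
    invThreeQuarterHom n ≤ 2 / 3 := by
  change (√√(n : ℝ))⁻¹ ^ 3 ≤ 2 / 3
  have hn' : (2 : ℝ) ≤ n := by exact_mod_cast hn
  have h : (23 / 20 : ℝ) ≤ √√(n : ℝ) := by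
    refine Real.le_sqrt_of_sq_le (Real.le_sqrt_of_sq_le ?_)
    norm_num
    linarith
  calc (√√(n : ℝ))⁻¹ ^ 3 ≤ (23 / 20 : ℝ)⁻¹ ^ 3 := by gcongr
    _ ≤ 2 / 3 := by norm_num

theorem prod_primesBelow_invThreeQuarterHom_le (Z : ℕ) :
    ∏ p ∈ Z.primesBelow, (1 - invThreeQuarterHom p)⁻¹ ≤ Real.exp (12 * √√(Z : ℝ)) := by
  have h1 : ∀ p ∈ Z.primesBelow, (1 - invThreeQuarterHom p)⁻¹ ≤
      Real.exp (3 * invThreeQuarterHom p) := by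
    intro p hp
    have h2 := invThreeQuarterHom_le_of_two_le (Nat.prime_of_mem_primesBelow hp).two_le
    have h0 := invThreeQuarterHom_nonneg p
    generalize invThreeQuarterHom p = t at *
    rw [inv_le_iff_one_le_mul₀ (by linarith)]
    have h3 := Real.add_one_le_exp (3 * t)
    -- `(1 - t)(1 + 3t) ≥ 1` holds exactly for `0 ≤ t ≤ 2/3`, which is why the bound `2/3` was
    -- needed.
    nlinarith
  refine (prod_le_prod (fun p hp ↦ ?_) h1).trans ?_
  · have h2 := invThreeQuarterHom_le_of_two_le (Nat.prime_of_mem_primesBelow hp).two_le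
    exact inv_nonneg.2 (by linarith)
  · rw [← Real.exp_sum, ← mul_sum]
    refine Real.exp_le_exp.2 ?_
    have h2 : ∑ p ∈ Z.primesBelow, invThreeQuarterHom p ≤
        ∑ k ∈ range (Z + 1), invThreeQuarterHom k := by
      refine sum_le_sum_of_subset_of_nonneg ?_ fun k _ _ ↦ invThreeQuarterHom_nonneg k
      intro p hp
      exact mem_range.2 ((Nat.lt_of_mem_primesBelow hp).trans (Nat.lt_succ_self Z))
    have := sum_range_invThreeQuarterHom_le Z
    linarith

/-- Rankin's bound for the sum of reciprocals of large smooth numbers. -/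
theorem sum_inv_smooth_gt_le {Z Y : ℕ} (hY : 1 ≤ Y) {s : Finset ℕ}
    (hs : ∀ d ∈ s, d ∈ Nat.smoothNumbers Z ∧ Y < d) :
    ∑ d ∈ s, (d : ℝ)⁻¹ ≤ Real.exp (12 * √√(Z : ℝ)) / √√(Y : ℝ) := by
  have hY0 : (0 : ℝ) < Y := by exact_mod_cast hY
  -- Rankin's trick: `d⁻¹ = d^(-1/4) d^(-3/4)`, and `d > Y` bounds the first factor.
  have h1 : ∀ d ∈ s, (d : ℝ)⁻¹ ≤ (√√(Y : ℝ))⁻¹ * invThreeQuarterHom d := by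
    intro d hd
    have hYd : (Y : ℝ) ≤ d := by exact_mod_cast (hs d hd).2.le
    have hd0 : (0 : ℝ) < d := hY0.trans_le hYd
    change (d : ℝ)⁻¹ ≤ (√√(Y : ℝ))⁻¹ * (√√(d : ℝ))⁻¹ ^ 3
    calc (d : ℝ)⁻¹ = (√√(d : ℝ))⁻¹ * (√√(d : ℝ))⁻¹ ^ 3 := by
          conv_lhs => rw [← sqrt_sqrt_pow_four hd0.le]
          rw [← inv_pow]
          ring
      _ ≤ _ := by gcongr
  refine (sum_le_sum h1).trans ?_
  rw [← mul_sum, div_eq_inv_mul]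
  refine mul_le_mul_of_nonneg_left ?_ (by positivity)
  refine (sum_le_prod_primesBelow invThreeQuarterHom_nonneg (fun p hp ↦ ?_)
    fun d hd ↦ (hs d hd).1).trans (prod_primesBelow_invThreeQuarterHom_le Z)
  exact (invThreeQuarterHom_le_of_two_le hp.two_le).trans_lt (by norm_num)

/-! ### Sizes of the exceptional families -/

theorem card_le_sum_div_of_exists_dvd {N : ℕ} {t s : Finset ℕ} (f : ℕ → ℕ)
    (ht : ∀ n ∈ t, (1 ≤ n ∧ n ≤ N) ∧ ∃ d ∈ s, f d ∣ n) :
    (#t : ℝ) ≤ N * ∑ d ∈ s, (f d : ℝ)⁻¹ := by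
  classical
  have hsub : t ⊆ s.biUnion fun d ↦ (Ioc 0 N).filter fun n ↦ f d ∣ n := by
    intro n hn
    obtain ⟨⟨h1, h2⟩, d, hd, hdn⟩ := ht n hn
    exact mem_biUnion.2 ⟨d, hd, mem_filter.2 ⟨mem_Ioc.2 ⟨h1, h2⟩, hdn⟩⟩
  have h : #t ≤ ∑ d ∈ s, N / f d := by
    refine (card_le_card hsub).trans (card_biUnion_le.trans (sum_le_sum fun d _ ↦ ?_))
    rw [Nat.Ioc_filter_dvd_card_eq_div]
  calc (#t : ℝ) ≤ ((∑ d ∈ s, N / f d : ℕ) : ℝ) := by exact_mod_cast h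
    _ = ∑ d ∈ s, ((N / f d : ℕ) : ℝ) := by push_cast; rfl
    _ ≤ ∑ d ∈ s, (N : ℝ) * (f d : ℝ)⁻¹ := by
      refine sum_le_sum fun d _ ↦ ?_
      rw [← div_eq_mul_inv]
      exact Nat.cast_div_le
    _ = N * ∑ d ∈ s, (f d : ℝ)⁻¹ := by rw [mul_sum]

theorem card_withSmoothDivisor_le (N Z Y : ℕ) (hY : 1 ≤ Y) :
    (#(withSmoothDivisor N Z Y) : ℝ) ≤ N * (Real.exp (12 * √√(Z : ℝ)) / √√(Y : ℝ)) := by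
  classical
  refine (card_le_sum_div_of_exists_dvd (N := N)
    (s := (Icc 1 N).filter fun d ↦ d ∈ Nat.smoothNumbers Z ∧ Y < d) (fun d ↦ d) ?_).trans ?_
  · intro n hn
    simp only [withSmoothDivisor, mem_filter, mem_Icc] at hn
    obtain ⟨⟨h1, h2⟩, d, hd, hYd, hdn⟩ := hn
    refine ⟨⟨h1, h2⟩, d, mem_filter.2 ⟨mem_Icc.2 ⟨by omega, ?_⟩, hd, hYd⟩, hdn⟩
    exact (Nat.le_of_dvd h1 hdn).trans h2
  · exact mul_le_mul_of_nonneg_left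
      (sum_inv_smooth_gt_le hY fun d hd ↦ (mem_filter.1 hd).2) (by positivity)

theorem card_withSquareDivisor_le (N Z : ℕ) (hZ : 1 ≤ Z) :
    (#(withSquareDivisor N Z) : ℝ) ≤ N * (2 / Z) := by
  refine (card_le_sum_div_of_exists_dvd (N := N) (s := Ioo (Z - 1) (N + 1))
    (fun d ↦ d ^ 2) ?_).trans ?_
  · intro n hn
    simp only [withSquareDivisor, mem_filter, mem_Icc] at hn
    obtain ⟨⟨h1, h2⟩, d, hd, hdn⟩ := hn
    refine ⟨⟨h1, h2⟩, d, mem_Ioo.2 ⟨by omega, ?_⟩, hdn⟩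
    have := (Nat.le_of_dvd h1 hdn).trans h2
    have := Nat.le_self_pow two_ne_zero d
    omega
  · have h := sum_Ioo_inv_sq_le (α := ℝ) (Z - 1) (N + 1)
    have hc : ((Z - 1 : ℕ) : ℝ) + 1 = Z := by
      rw [Nat.cast_sub hZ]
      push_cast
      ring
    rw [hc] at h
    refine mul_le_mul_of_nonneg_left ?_ (by positivity)
    simpa using h

/-! ### Chebyshev's bound and counts of prime factors -/

theorem primeCounting_floor_le {x : ℝ} (hx : 1 < x) :
    (Nat.primeCounting ⌊x⌋₊ : ℝ) ≤ 6 * (x / Real.log x) := by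
  have hx0 : 0 < x := by linarith
  have hL : 0 < Real.log x := Real.log_pos hx
  refine (Chebyshev.pi_le_log4_mul_div hx).trans ?_
  have h1 : Real.log √x = Real.log x / 2 := Real.log_sqrt hx0.le
  have h2 : Real.log 4 ≤ 2 := by
    rw [show (4 : ℝ) = 2 ^ 2 by norm_num, Real.log_pow]
    have := Real.log_two_lt_d9
    push_cast
    linarith
  have h3 : √x ≤ 2 * (x / Real.log x) := by
    rw [← mul_div_assoc, le_div_iff₀ hL]
    have h4 : Real.log √x ≤ √x := Real.log_le_self (Real.sqrt_nonneg x)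
    have h5 : √x * √x = x := Real.mul_self_sqrt hx0.le
    nlinarith [Real.sqrt_nonneg x]
  have h4 : Real.log 4 * x / Real.log √x ≤ 4 * (x / Real.log x) := by
    rw [h1, div_le_iff₀ (by positivity)]
    have : 4 * (x / Real.log x) * (Real.log x / 2) = 2 * x := by field_simp; ring
    rw [this]
    gcongr
  linarith

theorem natLog_two_le {k : ℕ} (hk : 1 ≤ k) : (Nat.log 2 k : ℝ) ≤ 2 * Real.log k := by
  have h1 : ((2 ^ Nat.log 2 k : ℕ) : ℝ) ≤ k := by
    exact_mod_cast Nat.pow_log_le_self 2 (by omega)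
  have h2 := Real.log_le_log (by positivity) h1
  push_cast at h2
  rw [Real.log_pow] at h2
  have := Real.log_two_gt_d9
  have h3 : (0 : ℝ) ≤ Nat.log 2 k := by positivity
  nlinarith

theorem sum_card_primeFactors_le {f : ℕ → ℕ} {M N : ℕ} (hN : 1 ≤ N)
    (hf : ∀ m ∈ Icc 1 M, f m ≤ N ^ 2) :
    (∑ m ∈ Icc 1 M, #(f m).primeFactors : ℕ) ≤ M * (4 * Real.log N) := by
  push_cast
  refine (sum_le_card_nsmul _ _ (4 * Real.log N) fun m hm ↦ ?_).trans (by simp)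
  have h1 : #(f m).primeFactors ≤ Nat.log 2 (N ^ 2) :=
    (card_primeFactors_le_log _).trans (Nat.log_mono_right (hf m hm))
  have h2 := natLog_two_le (k := N ^ 2) (Nat.one_le_pow _ _ hN)
  push_cast at h2
  rw [Real.log_pow] at h2
  have h3 : (#(f m).primeFactors : ℝ) ≤ Nat.log 2 (N ^ 2) := by exact_mod_cast h1
  push_cast at h2
  linarith

/-- Chebyshev's bound summed over the cofactors `m ≤ x ^ (1 / 3)`. -/
theorem exists_sum_primeCounting_div_le :
    ∃ C : ℝ, 0 < C ∧ ∀ (x : ℝ) (Y : ℕ), 1 < x → (Y : ℝ) ≤ Real.exp (Real.log x / 3) →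
      (∑ m ∈ Icc 1 Y, Nat.primeCounting (⌊x⌋₊ / (m * greatestPrimeFactor m)) : ℕ) ≤
        C * (x / Real.log x) := by
  obtain ⟨C, hC, hsum⟩ := exists_sum_inv_mul_greatestPrimeFactor_le
  refine ⟨18 * C, by positivity, fun x Y hx hY ↦ ?_⟩
  have hx0 : 0 < x := by linarith
  have hL : 0 < Real.log x := Real.log_pos hx
  have key : ∀ m ∈ Icc 1 Y,
      (Nat.primeCounting (⌊x⌋₊ / (m * greatestPrimeFactor m)) : ℝ) ≤
        18 * (x / Real.log x) * ((m * greatestPrimeFactor m : ℕ) : ℝ)⁻¹ := by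
    intro m hm
    rw [mem_Icc] at hm
    have hk1 : 1 ≤ m * greatestPrimeFactor m :=
      Nat.mul_pos hm.1 (one_le_greatestPrimeFactor m)
    have hkY : m * greatestPrimeFactor m ≤ Y * Y :=
      Nat.mul_le_mul hm.2 ((Nat.le_of_dvd hm.1 (greatestPrimeFactor_dvd m)).trans hm.2)
    generalize m * greatestPrimeFactor m = k at *
    have hk0 : (0 : ℝ) < k := by exact_mod_cast hk1
    have hk : (k : ℝ) ≤ Real.exp (Real.log x / 3) * Real.exp (Real.log x / 3) := by
      calc (k : ℝ) ≤ (Y : ℝ) * Y := by exact_mod_cast hkY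
        _ ≤ _ := by gcongr
    -- Since `m P(m) ≤ Y² ≤ x^(2/3)`, the argument `x / k` is at least `x^(1/3)`; its logarithm
    -- loses a factor 3, whence `18 = 6 · 3`.
    have ht : Real.exp (Real.log x / 3) ≤ x / k := by
      rw [le_div_iff₀ hk0]
      calc Real.exp (Real.log x / 3) * k ≤ Real.exp (Real.log x / 3) *
            (Real.exp (Real.log x / 3) * Real.exp (Real.log x / 3)) := by gcongr
        _ = x := by
          rw [← Real.exp_add, ← Real.exp_add]
          conv_rhs => rw [← Real.exp_log hx0]
          congr 1
          ring
    have ht1 : 1 < x / k := (Real.one_lt_exp_iff.2 (by positivity)).trans_le ht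
    have hlog : Real.log x / 3 ≤ Real.log (x / k) :=
      (Real.le_log_iff_exp_le (by positivity)).2 ht
    rw [← Nat.floor_div_natCast]
    refine (primeCounting_floor_le ht1).trans ?_
    calc 6 * (x / k / Real.log (x / k)) ≤ 6 * (x / k / (Real.log x / 3)) := by gcongr
      _ = 18 * (x / Real.log x) * (k : ℝ)⁻¹ := by field_simp; ring
  push_cast
  refine (sum_le_sum key).trans ?_
  rw [← mul_sum]
  calc 18 * (x / Real.log x) * ∑ m ∈ Icc 1 Y, ((m * greatestPrimeFactor m : ℕ) : ℝ)⁻¹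
      ≤ 18 * (x / Real.log x) * C := by
        gcongr
        exact hsum Y
    _ = 18 * C * (x / Real.log x) := by ring

/-! ### Choice of parameters and conclusion -/

/-- With `s = √L`, the smooth product costs at most `exp(24s)` and the factor `2L` at most
`exp(3s)`, against a gain of `exp(s² / 12)`. This needs `s ≥ 27 · 12 = 324`, and `324² = 104976`. -/
theorem exp_div_sqrt_sqrt_le {L : ℝ} (hL : 104976 ≤ L) :
    Real.exp (12 * √√(⌈L ^ 2⌉₊ : ℝ)) / √√(⌊Real.exp (L / 3)⌋₊ : ℝ) ≤ 1 / L := by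
  have hL0 : 0 < L := by linarith
  set s := √L with hs
  have hsL : s ^ 2 = L := Real.sq_sqrt hL0.le
  have hs1 : 324 ≤ s := Real.le_sqrt_of_sq_le (by norm_num; linarith)
  have h1 : √√(⌈L ^ 2⌉₊ : ℝ) ≤ 2 * s := by
    refine Real.sqrt_le_iff.2 ⟨by positivity, Real.sqrt_le_iff.2 ⟨by positivity, ?_⟩⟩
    have h := Nat.ceil_lt_add_one (sq_nonneg L)
    have : ((2 * s) ^ 2) ^ 2 = 16 * L ^ 2 := by rw [mul_pow, hsL]; ring
    rw [this]
    nlinarith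
  have h2 : Real.exp (L / 12) / 2 ≤ √√(⌊Real.exp (L / 3)⌋₊ : ℝ) := by
    refine Real.le_sqrt_of_sq_le (Real.le_sqrt_of_sq_le ?_)
    have h := Nat.lt_floor_add_one (Real.exp (L / 3))
    have h3 : Real.exp (L / 3) = Real.exp (L / 12) ^ 4 := by
      rw [← Real.exp_nat_mul]
      congr 1
      push_cast
      ring
    have h4 := Real.add_one_le_exp (L / 3)
    have h5 : ((Real.exp (L / 12) / 2) ^ 2) ^ 2 = Real.exp (L / 3) / 16 := by
      rw [h3]
      ring
    rw [h5]
    linarith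
  have h3 : 2 * L ≤ Real.exp (3 * s) := by
    have h4 := Real.add_one_le_exp s
    have h5 : Real.exp (3 * s) = Real.exp s ^ 3 := by
      rw [← Real.exp_nat_mul]
      norm_num
    rw [h5, ← hsL]
    calc 2 * s ^ 2 ≤ s ^ 3 := by nlinarith [sq_nonneg s]
      _ ≤ Real.exp s ^ 3 := by gcongr; linarith
  rw [div_le_div_iff₀ (lt_of_lt_of_le (by positivity) h2) hL0, one_mul]
  refine le_trans ?_ h2
  rw [le_div_iff₀ two_pos]
  calc Real.exp (12 * √√(⌈L ^ 2⌉₊ : ℝ)) * L * 2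
      = Real.exp (12 * √√(⌈L ^ 2⌉₊ : ℝ)) * (2 * L) := by ring
    _ ≤ Real.exp (12 * (2 * s)) * Real.exp (3 * s) := by gcongr
    _ = Real.exp (27 * s) := by rw [← Real.exp_add]; congr 1; ring
    _ ≤ Real.exp (L / 12) := by
      refine Real.exp_le_exp.2 ?_
      rw [← hsL]
      nlinarith

theorem exists_card_solutions_le : ∃ C : ℝ, 0 < C ∧ ∀ (a : ℤ) (x : ℝ), 1 < x →
    104976 ≤ Real.log x → (#(solutions a ⌊x⌋₊) : ℝ) ≤ C * (x / Real.log x) := by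
  obtain ⟨C, hC, hsum⟩ := exists_sum_primeCounting_div_le
  -- The pieces sum to `2 + 1 + 2 + 6 + 4 + 2(C + 4) = 23 + 2C`.
  refine ⟨24 + 2 * C, by positivity, fun a x hx1 hL ↦ ?_⟩
  have hx0 : 0 < x := by linarith
  have hL0 : 0 < Real.log x := by linarith
  set L := Real.log x with hLdef
  have hxL : x / L ^ 2 * L = x / L := by field_simp
  have hN1 : 1 ≤ ⌊x⌋₊ := (Nat.one_le_floor_iff _).2 hx1.le
  have hNx : (⌊x⌋₊ : ℝ) ≤ x := Nat.floor_le hx0.le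
  have hlogN : Real.log ⌊x⌋₊ ≤ L := Real.log_le_log (by exact_mod_cast hN1) hNx
  set N := ⌊x⌋₊ with hN
  set Y := ⌊Real.exp (L / 3)⌋₊ with hY
  set Z := ⌈L ^ 2⌉₊ with hZ
  have hY1 : 1 ≤ Y := (Nat.one_le_floor_iff _).2 (Real.one_le_exp (by positivity))
  have hYle : (Y : ℝ) ≤ Real.exp (L / 3) := Nat.floor_le (Real.exp_nonneg _)
  have hZle : L ^ 2 ≤ Z := Nat.le_ceil _
  have hZ1 : 1 ≤ Z := Nat.one_le_ceil_iff.2 (by positivity)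
  have hNZ : ((N / Z : ℕ) : ℝ) ≤ x / L ^ 2 :=
    Nat.cast_div_le.trans (by gcongr)
  have b1 : (Y : ℝ) ≤ 2 * (x / L) := by
    refine hYle.trans ?_
    rw [← mul_div_assoc, le_div_iff₀ hL0]
    have h1 := Real.add_one_le_exp (2 * L / 3)
    have h2 : Real.exp (L / 3) * Real.exp (2 * L / 3) = x := by
      rw [← Real.exp_add, ← Real.exp_log hx0]
      congr 1
      rw [← hLdef]
      ring
    calc Real.exp (L / 3) * L ≤ Real.exp (L / 3) * (2 * Real.exp (2 * L / 3)) := by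
          gcongr
          linarith
      _ = 2 * x := by rw [← h2]; ring
  have b2 : (#(withSmoothDivisor N Z Y) : ℝ) ≤ x / L := by
    refine (card_withSmoothDivisor_le N Z Y hY1).trans ?_
    rw [div_eq_mul_one_div x L]
    exact mul_le_mul hNx (exp_div_sqrt_sqrt_le hL) (by positivity) hx0.le
  have b3 : (#(withSquareDivisor N Z) : ℝ) ≤ 2 * (x / L) := by
    refine (card_withSquareDivisor_le N Z hZ1).trans ?_
    calc (N : ℝ) * (2 / Z) ≤ x * (2 / L ^ 2) := by gcongr
      _ = 2 * (x / L ^ 2 * 1) := by ring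
      _ ≤ 2 * (x / L ^ 2 * L) := by gcongr; linarith
      _ = 2 * (x / L) := by rw [hxL]
  have b4 : (Nat.primeCounting N : ℝ) ≤ 6 * (x / L) := primeCounting_floor_le hx1
  have hlarge : ∀ f : ℕ → ℕ, (∀ m ∈ Icc 1 (N / Z), f m ≤ N ^ 2) →
      ((∑ m ∈ Icc 1 (N / Z), #(f m).primeFactors : ℕ) : ℝ) ≤ 4 * (x / L) := by
    intro f hf
    refine (sum_card_primeFactors_le hN1 hf).trans ?_
    calc ((N / Z : ℕ) : ℝ) * (4 * Real.log N) ≤ x / L ^ 2 * (4 * L) := by gcongr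
      _ = 4 * (x / L ^ 2 * L) := by ring
      _ = 4 * (x / L) := by rw [hxL]
  have b5 := hlarge (fun m ↦ ArithmeticFunction.sigma 1 m) fun m hm ↦
    (ArithmeticFunction.sigma_le_pow_succ 1 m).trans
      (Nat.pow_le_pow_left ((mem_Icc.1 hm).2.trans (Nat.div_le_self _ _)) 2)
  have b6 := hlarge (fun m ↦ m) fun m hm ↦
    ((mem_Icc.1 hm).2.trans (Nat.div_le_self _ _)).trans (Nat.le_self_pow two_ne_zero N)
  have b7 := hsum x Y hx1 hYle
  have hmain : (#(solutions a N) : ℝ) ≤ _ := Nat.cast_le.2 (card_solutions_le a N Z Y hZ1)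
  rw [Nat.cast_add, Nat.cast_add, Nat.cast_add, Nat.cast_add, Nat.cast_add, Nat.cast_mul,
    Nat.cast_add] at hmain
  refine hmain.trans ?_
  rw [Nat.cast_ofNat]
  have hxL0 : 0 ≤ x / L := by positivity
  linarith

theorem theorem1p3 :
    ∃ C : ℝ, 0 < C ∧ ∀ (a : ℤ) (x : ℝ), 2 ≤ x →
      (Set.ncard {n : ℕ | 1 ≤ n ∧ (n : ℝ) ≤ x ∧
          ((ArithmeticFunction.sigma 1 n : ℕ) : ℤ) ≡ a [ZMOD (n : ℤ)]} : ℝ)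
        ≤ C * (x / Real.log x) := by
  obtain ⟨C, hC, h⟩ := exists_card_solutions_le
  refine ⟨C + 104976, by positivity, fun a x hx ↦ ?_⟩
  have hx0 : 0 < x := by linarith
  have hL : 0 < Real.log x := Real.log_pos (by linarith)
  have hset : {n : ℕ | 1 ≤ n ∧ (n : ℝ) ≤ x ∧
      ((ArithmeticFunction.sigma 1 n : ℕ) : ℤ) ≡ a [ZMOD (n : ℤ)]} = solutions a ⌊x⌋₊ := by
    ext n
    rw [mem_coe, mem_solutions, Nat.le_floor_iff hx0.le, and_assoc]
    rfl
  rw [hset, Set.ncard_coe_finset]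
  have hxL : 0 ≤ x / Real.log x := by positivity
  rcases le_or_gt 104976 (Real.log x) with hl | hl
  · refine (h a x (by linarith) hl).trans ?_
    gcongr
    linarith
  -- For bounded `log x` the trivial count `x = log x · (x / log x)` is enough.
  · have h1 : #(solutions a ⌊x⌋₊) ≤ ⌊x⌋₊ := by
      refine (card_le_card (t := Icc 1 ⌊x⌋₊) fun n hn ↦ ?_).trans (by simp)
      exact mem_Icc.2 (mem_solutions.1 hn).1
    calc (#(solutions a ⌊x⌋₊) : ℝ) ≤ (⌊x⌋₊ : ℝ) := by exact_mod_cast h1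
      _ ≤ x := Nat.floor_le hx0.le
      _ = Real.log x * (x / Real.log x) := by field_simp
      _ ≤ (C + 104976) * (x / Real.log x) := by gcongr; linarith
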